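/- A \emph{cpo} is a poset in which every chain (including the empty one) has a join, and a \emph{cpo map} is a map preserving joins of all chains; these form the category $\mathbf{CPO}$. Let $2$ and $3$ denote the chains with two and three elements. Let $\kappa$ be a cardinal, let $A_\alpha$ ($\alpha$ an ordinal) be cpo's, and let $f_{\alpha,\beta}\colon A_\alpha\to A_\beta$ ($\alpha\le\beta$) be cpo maps such that $f_{\alpha,\alpha}=\mathrm{id}_{A_\alpha}$ for all $\alpha$ and $f_{\beta,\gamma}\cdot f_{\alpha,\beta}=f_{\alpha,\gamma}$ for all $\alpha\le\beta\le\gamma$. Assume that in $\mathbf{CPO}$ - $A_0=\kappa\cdot 3$ is a coproduct of $\kappa$ many copies of $3$; - for each ordinal $\alpha$, the map $f_{\alpha,\alpha+1}$ is a coequalizer of some pair of cpo maps $2\rightrightarrows A_\alpha$; - for each limit ordinal $\alpha$, $A_\alpha=\operatorname{colim}_{\beta<\alpha}A_\beta$, with the maps $f_{\beta,\alpha}$ as colimit cocone. Then for each ordinal $\alpha$: 1. if $\kappa$ is infinite, then $|A_\alpha|\le 2^\kappa$; 2. if $\kappa$ is finite, then $|A_\alpha|\le 2\kappa+1$; 3.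 call an element of $A_\alpha$ old if it lies in the image of $f_{0,\alpha}\colon A_0\to A_\alpha$, and new otherwise; if $a,b\in A_\alpha$ are new and $\{c<a : c \text{ old}\}=\{c<b : c\text{ old}\}$, then $a=b$. -/

import Mathlib

open CategoryTheory CategoryTheory.Limits

universe u

/-- A cpo (chain-complete poset): a poset in which every chain, the empty one included,
has a join. -/
structure CPO : Type (u + 1) where
  carrier : Type u
  [str : PartialOrder carrier]
  exists_isLUB : ∀ s : Set carrier, IsChain (· ≤ ·) s → ∃ a, IsLUB s a

namespace CPO

instance : CoeSort CPO.{u} (Type u) := ⟨carrier⟩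

instance (A : CPO.{u}) : PartialOrder A := A.str

/-- A cpo map: a map preserving joins of all chains (the empty chain included). Such a map is
monotone, since a pair `x ≤ y` is a chain with join `y`. -/
@[ext]
structure Hom (A B : CPO.{u}) : Type u where
  toFun : A → B
  map_isLUB' : ∀ (s : Set A) (a : A), IsChain (· ≤ ·) s → IsLUB s a → IsLUB (toFun '' s) (toFun a)

instance (A B : CPO.{u}) : FunLike (Hom A B) A B where
  coe := Hom.toFun
  coe_injective := fun _ _ h => Hom.ext h

theorem Hom.map_isLUB {A B : CPO.{u}} (f : Hom A B) {s : Set A} {a : A}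
    (hs : IsChain (· ≤ ·) s) (ha : IsLUB s a) : IsLUB (f '' s) (f a) :=
  f.map_isLUB' s a hs ha

theorem Hom.monotone {A B : CPO.{u}} (f : Hom A B) : Monotone f := by
  intro x y hxy
  have hc : IsChain (· ≤ ·) ({x, y} : Set A) := IsChain.pair hxy
  have hl : IsLUB ({x, y} : Set A) y :=
    ⟨by rintro z (rfl | rfl) <;> simp [hxy], fun b hb => hb (by simp)⟩
  exact (f.map_isLUB hc hl).1 ⟨x, by simp, rfl⟩

/-- The identity cpo map. -/
def Hom.id (A : CPO.{u}) : Hom A A where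
  toFun := fun a => a
  map_isLUB' := by
    intro s a _ ha
    simpa using ha

/-- The composite cpo map `a ↦ g (f a)`. -/
def Hom.comp {A B C : CPO.{u}} (f : Hom A B) (g : Hom B C) : Hom A C where
  toFun := fun a => g (f a)
  map_isLUB' := by
    intro s a hs ha
    have h := g.map_isLUB (f.monotone.isChain_image hs) (f.map_isLUB hs ha)
    rwa [Set.image_image] at h

/-- The category of cpo's and cpo maps. -/
instance : LargeCategory.{u} CPO.{u} where
  Hom := Hom
  id := Hom.id
  comp := Hom.comp

instance : ConcreteCategory.{u} CPO.{u} Hom where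
  hom f := f
  ofHom f := f

/-- The finite chain `0 < 1 < ⋯ < n`, with `n + 1` elements, as a cpo. -/
def finChain (n : ℕ) : CPO.{u} where
  carrier := ULift.{u} (Fin (n + 1))
  exists_isLUB := by
    intro s _
    obtain ⟨a, ha⟩ : ∃ a, IsLUB (ULift.down '' s) a := ⟨_, isLUB_sSup _⟩
    exact ⟨⟨a⟩, fun x hx => ha.1 ⟨x, hx, rfl⟩,
      fun b hb => ha.2 (by rintro _ ⟨x, hx, rfl⟩; exact hb hx)⟩

/-- The two-element chain `2`. -/
abbrev two : CPO.{u} := finChain 1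

/-- The three-element chain `3`. -/
abbrev three : CPO.{u} := finChain 2

/-- `A` is a coproduct `κ · X` of `κ` many copies of `X`. -/
def IsCopower (κ : Cardinal.{u}) (X A : CPO.{u}) : Prop :=
  ∃ ι : κ.out → (X ⟶ A), Nonempty (IsColimit (Cofan.mk A ι))

/-- `f` is a coequalizer of some pair of morphisms whose domain is `X`. -/
def IsCoequalizerOfPairFrom (X : CPO.{u}) {A B : CPO.{u}} (f : A ⟶ B) : Prop :=
  ∃ (g h : X ⟶ A) (w : g ≫ f = h ≫ f), Nonempty (IsColimit (Cofork.ofπ f w))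

/-- The connecting map `f_{α, β} : A_α → A_β` of a chain of cpo's indexed by the ordinals. -/
abbrev chainMap (A : Ordinal.{u} ⥤ CPO.{u}) {α β : Ordinal.{u}} (h : α ≤ β) :
    A.obj α ⟶ A.obj β :=
  A.map (homOfLE h)

/-- The chain `A` starts at `κ · 3`, every step from `α` to `α + 1` is a coequalizer of a pair of
maps out of `2`, and `A_α` is the colimit of the `A_β` with `β < α` (with the connecting maps
as colimit cocone) for each limit ordinal `α`. -/
structure IsQuotientChain (κ : Cardinal.{u}) (A : Ordinal.{u} ⥤ CPO.{u}) : Prop where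
  zero : IsCopower κ three (A.obj 0)
  succ : ∀ α : Ordinal.{u},
    IsCoequalizerOfPairFrom two (chainMap A (le_self_add : α ≤ α + 1))
  limit : ∀ α : Ordinal.{u}, Order.IsSuccLimit α →
    Nonempty (IsColimit ((Set.principalSegIio α).cocone A))

/-- The old elements of `A_α`: those with a representative in `A_0`. The other elements of `A_α`
are called new. -/
def oldElements (A : Ordinal.{u} ⥤ CPO.{u}) (α : Ordinal.{u}) : Set (A.obj α) :=
  Set.range (chainMap A (zero_le (a := α)))

end CPO

/-!
Call a subset of a cpo *chain-closed* if it contains the joins of all its chains; such a subset is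
again a cpo, and its inclusion is a cpo map. Everything rests on the fact that the old elements
generate each `A_α`: a chain-closed subset of `A_α` that contains all of them is the whole of `A_α`
(`IsQuotientChain.generates_oldElements`). Indeed a chain-closed subset of a colimit that contains
the images of all the legs is everything (`chainClosed_eq_univ_of_isColimit`): the cocone factors
through the subset, so that the inclusion of the subset is a split epimorphism. Since preimages of
chain-closed sets are chain-closed, transfinite induction on `α` gives the claim. The same fact for
the coproduct `κ · 3` shows that `A_α` is even generated by the images of the `2κ + 1` elements
consisting of the least element and the two other elements of each copy of `3`.

If a set `G` generates a cpo, every element is the join of the elements of `G` below it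
(`isLUB_of_generates`), because the elements with this property form a chain-closed set that
contains `G`. With `G` the set of old elements this says that a new element is determined by the
old elements strictly below it; with `G` the set of generators above it embeds `A_α` into the power
set of a set of size `2κ + 1`. If `κ` is finite, then a finite set that contains the least element
is already chain-closed, so that `A_α` consists of the `2κ + 1` generators.
-/

namespace CPO

/-- A set is chain-closed if it contains the joins of all chains of its elements, the join of the
empty chain included. -/
def ChainClosed {A : CPO.{u}} (T : Set A) : Prop :=
  ∀ (s : Set A) (a : A), s ⊆ T → IsChain (· ≤ ·) s → IsLUB s a → a ∈ T

/-- `G` generates `A` under joins of chains. -/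
def Generates {A : CPO.{u}} (G : Set A) : Prop :=
  ∀ T : Set A, ChainClosed T → G ⊆ T → T = Set.univ

/-! ### Chain-closed subsets -/

theorem ChainClosed.preimage {A B : CPO.{u}} (f : A ⟶ B) {T : Set B} (hT : ChainClosed T) :
    ChainClosed (f ⁻¹' T) := fun s a hsT hs ha =>
  hT (f '' s) (f a) (by rintro _ ⟨x, hx, rfl⟩; exact hsT hx)
    ((Hom.monotone f).isChain_image hs) (Hom.map_isLUB f hs ha)

theorem isChain_image_val {A : CPO.{u}} {T : Set A} {s : Set T} (hs : IsChain (· ≤ ·) s) :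
    IsChain (· ≤ ·) (Subtype.val '' s) :=
  (Subtype.mono_coe (· ∈ T)).isChain_image hs

theorem isLUB_of_isLUB_image_val {A : CPO.{u}} {T : Set A} {s : Set T} {a : T}
    (h : IsLUB (Subtype.val '' s) a.1) : IsLUB s a :=
  ⟨fun x hx => h.1 ⟨x, hx, rfl⟩, fun b hb => h.2 (by rintro _ ⟨x, hx, rfl⟩; exact hb hx)⟩

/-- A chain-closed subset of a cpo as a cpo. -/
def ChainClosed.cpo {A : CPO.{u}} {T : Set A} (hT : ChainClosed T) : CPO.{u} where
  carrier := T
  exists_isLUB := by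
    intro s hs
    obtain ⟨a, ha⟩ := A.exists_isLUB _ (isChain_image_val hs)
    have haT : a ∈ T := hT _ a (by rintro _ ⟨x, _, rfl⟩; exact x.2) (isChain_image_val hs) ha
    exact ⟨⟨a, haT⟩, isLUB_of_isLUB_image_val ha⟩

/-- The inclusion of a chain-closed subset as a cpo map. -/
def ChainClosed.incl {A : CPO.{u}} {T : Set A} (hT : ChainClosed T) : hT.cpo ⟶ A :=
  Hom.mk (A := hT.cpo) (fun x => x.1) <| by
    intro s a hs ha
    have hs' : IsChain (· ≤ ·) (Subtype.val '' s : Set A) := isChain_image_val (T := T) hs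
    obtain ⟨b, hb⟩ := A.exists_isLUB _ hs'
    have hbT : b ∈ T := hT _ b (by rintro _ ⟨x, _, rfl⟩; exact x.2) hs' hb
    have hab : a = (⟨b, hbT⟩ : T) := ha.unique (isLUB_of_isLUB_image_val (T := T) hb)
    subst hab
    exact hb

/-- A cpo map with values in a chain-closed subset, as a cpo map into that subset. -/
def ChainClosed.lift {A B : CPO.{u}} {T : Set A} (hT : ChainClosed T) (f : B ⟶ A)
    (hf : ∀ x, f x ∈ T) : B ⟶ hT.cpo :=
  Hom.mk (B := hT.cpo) (fun x => ⟨f x, hf x⟩) <| by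
    intro s a hs ha
    refine isLUB_of_isLUB_image_val (T := T) ?_
    exact (Set.image_image (Subtype.val : T → A) (fun x => ⟨f x, hf x⟩) s).symm ▸
      Hom.map_isLUB f hs ha

theorem chainClosed_eq_univ_of_isColimit {J : Type*} [Category J] {F : J ⥤ CPO.{u}}
    {c : Cocone F} (hc : IsColimit c) {T : Set c.pt} (hT : ChainClosed T)
    (h : ∀ (j : J) (x : F.obj j), c.ι.app j x ∈ T) : T = Set.univ := by
  let d : Cocone F :=
    { pt := hT.cpo
      ι :=
        { app := fun j => hT.lift (c.ι.app j) (h j)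
          naturality := fun i j f => Hom.ext <| funext fun x => Subtype.ext <|
            congrArg (fun g : F.obj i ⟶ c.pt => g x) (c.w f) } }
  have hd : hc.desc d ≫ hT.incl = 𝟙 c.pt := by
    refine hc.hom_ext fun j => ?_
    rw [← Category.assoc, hc.fac, Category.comp_id]
    rfl
  refine Set.eq_univ_of_forall fun x => ?_
  have hx : (hc.desc d x : T).1 = x := congrArg (fun g : c.pt ⟶ c.pt => g x) hd
  rw [← hx]
  exact (hc.desc d x : T).2

/-! ### Generating sets -/

theorem isLUB_of_generates {A : CPO.{u}} {G : Set A} (hG : Generates G) (a : A) :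
    IsLUB {c | c ∈ G ∧ c ≤ a} a := by
  have h : {a : A | IsLUB {c | c ∈ G ∧ c ≤ a} a} = Set.univ := by
    refine hG _ (fun s a hsT _ ha => ⟨fun c hc => hc.2, fun u hu => ha.2 fun x hx => ?_⟩)
      fun g hg => ⟨fun c hc => hc.2, fun u hu => hu ⟨hg, le_rfl⟩⟩
    exact (hsT hx).2 fun c hc => hu ⟨hc.1, hc.2.trans (ha.1 hx)⟩
  exact h.ge (Set.mem_univ a)

theorem chainClosed_of_finite {A : CPO.{u}} {T : Set A} (hT : T.Finite) {b : A}
    (hb : IsLeast Set.univ b) (hbT : b ∈ T) : ChainClosed T := by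
  intro s a hsT hs ha
  rcases s.eq_empty_or_nonempty with rfl | hne
  · have : a = b := le_antisymm (ha.2 (by simp)) (hb.2 (Set.mem_univ a))
    exact this ▸ hbT
  · obtain ⟨m, hms, hm⟩ := (hT.subset hsT).exists_maximal hne
    -- A maximal element of a chain is its greatest element.
    have hmax : IsGreatest s m := ⟨hms, fun x hx => (hs.total hx hms).elim id (hm hx)⟩
    exact ha.unique hmax.isLUB ▸ hsT hms

theorem Hom.map_isLeast {A B : CPO.{u}} (f : A ⟶ B) {b : A} (hb : IsLeast Set.univ b) :
    IsLeast Set.univ (f b) := by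
  have h : IsLUB (∅ : Set A) b := isLUB_empty_iff.2 fun x => hb.2 (Set.mem_univ x)
  have h' := Hom.map_isLUB f IsChain.empty h
  rw [Set.image_empty] at h'
  exact ⟨Set.mem_univ _, fun x _ => h'.2 (by simp)⟩

theorem Generates.image {A B : CPO.{u}} {G : Set A} (hG : Generates G) {f : A ⟶ B}
    (hf : Generates (Set.range f)) : Generates (f '' G) := by
  refine fun T hT hGT => hf T hT ?_
  have := hG _ (hT.preimage f) (Set.image_subset_iff.1 hGT)
  rintro _ ⟨x, rfl⟩
  exact this.ge (Set.mem_univ x)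

/-- A cpo generated by the image of a type `I` embeds into the power set of `I`. -/
theorem mk_le_of_generates {A : CPO.{u}} {I : Type u} {g : I → A}
    (hg : Generates (Set.range g)) : Cardinal.mk A ≤ 2 ^ Cardinal.mk I := by
  rw [← Cardinal.mk_set]
  refine Cardinal.mk_le_of_injective (f := fun a => {i | g i ≤ a}) fun a b hab => ?_
  have h : {c | c ∈ Set.range g ∧ c ≤ a} = {c | c ∈ Set.range g ∧ c ≤ b} := by
    ext c
    constructor <;> rintro ⟨⟨i, rfl⟩, hi⟩
    · exact ⟨⟨i, rfl⟩, (Set.ext_iff.1 hab i).1 hi⟩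
    · exact ⟨⟨i, rfl⟩, (Set.ext_iff.1 hab i).2 hi⟩
  exact (isLUB_of_generates hg a).unique (h ▸ isLUB_of_generates hg b)

theorem mk_le_of_generates_of_finite {A : CPO.{u}} {I : Type u} [Finite I] {g : I → A}
    (hg : Generates (Set.range g)) {i : I} (hi : IsLeast Set.univ (g i)) :
    Cardinal.mk A ≤ Cardinal.mk I := by
  have h := hg _ (chainClosed_of_finite (Set.finite_range g) hi ⟨i, rfl⟩) le_rfl
  exact Cardinal.mk_le_of_surjective (Set.range_eq_univ.1 h)

theorem exists_isLeast (A : CPO.{u}) : ∃ b : A, IsLeast Set.univ b := by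
  obtain ⟨b, hb⟩ := A.exists_isLUB ∅ IsChain.empty
  exact ⟨b, Set.mem_univ b, fun x _ => hb.2 (by simp)⟩

/-- The copower `κ · 3` is generated by its least element, which is indexed by `none`, and the two
remaining elements of each copy of `3`. -/
theorem IsCopower.exists_generates {κ : Cardinal.{u}} {A : CPO.{u}} (hA : IsCopower κ three A) :
    ∃ g : Option (κ.out × Fin 2) → A, Generates (Set.range g) ∧ IsLeast Set.univ (g none) := by
  obtain ⟨ι, ⟨hc⟩⟩ := hA
  obtain ⟨b, hb⟩ := A.exists_isLeast
  refine ⟨fun o => o.elim b fun p => ι p.1 (ULift.up p.2.succ), fun T hT hGT => ?_, hb⟩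
  refine chainClosed_eq_univ_of_isColimit hc (T := T) hT ?_
  rintro ⟨i⟩ ⟨k⟩
  change ι i (ULift.up k) ∈ T
  refine Fin.cases ?_ (fun j => hGT ⟨some (i, j), rfl⟩) k
  have h0 : IsLeast Set.univ (ι i (ULift.up 0)) :=
    Hom.map_isLeast (ι i) ⟨Set.mem_univ _, fun x _ => Fin.zero_le x.down⟩
  exact h0.unique hb ▸ hGT ⟨none, rfl⟩

/-! ### Quotient chains -/

theorem IsQuotientChain.generates_oldElements {κ : Cardinal.{u}} {A : Ordinal.{u} ⥤ CPO.{u}}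
    (hA : IsQuotientChain κ A) (α : Ordinal.{u}) : Generates (oldElements A α) := by
  have key : ∀ {β γ : Ordinal.{u}} (h : β ≤ γ) {T : Set (A.obj γ)}, Generates (oldElements A β) →
      ChainClosed T → oldElements A γ ⊆ T → ∀ x, chainMap A h x ∈ T := by
    intro β γ h T hβ hT hGT x
    refine (hβ _ (hT.preimage (chainMap A h)) ?_).ge (Set.mem_univ x)
    rintro _ ⟨y, rfl⟩
    refine hGT ⟨y, ?_⟩
    exact congrArg (fun f : A.obj 0 ⟶ A.obj γ => f y)
      (A.map_comp (homOfLE (zero_le (a := β))) (homOfLE h))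
  induction α using Ordinal.limitRecOn with
  | zero =>
    refine fun T _ hGT => Set.eq_univ_of_forall fun x => hGT ⟨x, ?_⟩
    exact congrArg (fun f : A.obj 0 ⟶ A.obj 0 => f x) (A.map_id 0)
  | add_one α ih =>
    intro T hT hGT
    obtain ⟨g, h, w, ⟨hc⟩⟩ := hA.succ α
    refine chainClosed_eq_univ_of_isColimit hc (T := T) hT ?_
    have hone := key (le_self_add : α ≤ α + 1) ih hT hGT
    rintro (_ | _) x
    -- The leg at the domain of the pair factors through the coequalizer.
    · exact hone (g x)
    · exact hone x
  | limit α hα ih =>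
    intro T hT hGT
    obtain ⟨hc⟩ := hA.limit α hα
    exact chainClosed_eq_univ_of_isColimit hc (T := T) hT fun β x =>
      key β.2.le (ih β.1 β.2) hT hGT x

end CPO

theorem mainTheorem3 (κ : Cardinal.{u}) (A : Ordinal.{u} ⥤ CPO.{u})
    (hA : CPO.IsQuotientChain κ A) (α : Ordinal.{u}) :
    (Cardinal.aleph0 ≤ κ → Cardinal.mk (A.obj α) ≤ 2 ^ κ) ∧
    (κ < Cardinal.aleph0 → Cardinal.mk (A.obj α) ≤ 2 * κ + 1) ∧
    (∀ a b : A.obj α, a ∉ CPO.oldElements A α → b ∉ CPO.oldElements A α →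
      {c | c ∈ CPO.oldElements A α ∧ c < a} = {c | c ∈ CPO.oldElements A α ∧ c < b} →
      a = b) := by
  have hold := hA.generates_oldElements α
  obtain ⟨g, hg, hmin⟩ := hA.zero.exists_generates
  have hG : CPO.Generates (Set.range (CPO.chainMap A (zero_le (a := α)) ∘ g)) := by
    rw [Set.range_comp]
    exact hg.image hold
  have hmk : Cardinal.mk (Option (κ.out × Fin 2)) = 2 * κ + 1 := by
    simp [mul_comm]
  refine ⟨fun hκ => ?_, fun hκ => ?_, fun a b ha hb hab => ?_⟩
  · refine (CPO.mk_le_of_generates hG).trans_eq ?_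
    rw [hmk, Cardinal.mul_eq_right hκ (Cardinal.ofNat_lt_aleph0.le.trans hκ) two_ne_zero,
      Cardinal.add_one_eq hκ]
  · have : Finite κ.out := Cardinal.mk_lt_aleph0_iff.1 (by rwa [Cardinal.mk_out])
    rw [← hmk]
    exact CPO.mk_le_of_generates_of_finite hG (i := none) (CPO.Hom.map_isLeast _ hmin)
  · -- For a new element, the old elements below it are strictly below it.
    have hlt : ∀ x : A.obj α, x ∉ CPO.oldElements A α →
        IsLUB {c | c ∈ CPO.oldElements A α ∧ c < x} x := by
      intro x hx
      convert CPO.isLUB_of_generates hold x using 1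
      ext c
      exact ⟨fun h => ⟨h.1, h.2.le⟩, fun h => ⟨h.1, h.2.lt_of_ne fun e => hx (e ▸ h.1)⟩⟩
    exact (hlt a ha).unique (hab ▸ hlt b hb)
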